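/- For a simply connected domain $\Omega\subsetneq\mathbb C$ let $\rho_\Omega(z)|dz|$ be the hyperbolic metric of Gaussian curvature $-1$ on $\Omega$ (so that $\rho_{\mathbb D}(z)=2/(1-|z|^2)$ for the unit disk $\mathbb D$), and let $h_\Omega(z_1,z_2)$ be the hyperbolic distance that it induces. For a compact set $E\subset\Omega$ with at least two points put $$h_\Omega(E)=\sup_{z_1,z_2\in E}h_\Omega(z_1,z_2),\qquad J_\Omega(E)=\log\Bigl(1+\frac{d(E)}{d(E,\partial\Omega)}\Bigr),$$ where $d(E)$ is the Euclidean diameter of $E$ and $d(E,\partial\Omega)$ is the Euclidean distance from $E$ to the boundary of $\Omega$. Let $\kappa(\Omega)=\inf_E h_\Omega(E)/J_\Omega(E)$, the infimum over all compact $E\subset\Omega$ with at least two points, and let $\kappa_0=\inf_\Omega\kappa(\Omega)$, the infimum over all simply connected proper subdomains $\Omega$ of $\mathbb C$. Then $$\frac14\le\kappa_0<0.4251605.$$ Moreover, for the slit plane $\Omega_0=\mathbb C\setminus(-\infty,0]$ and the three-point set $E=\{w_0,w_1,w_2\}$ with $w_0=1$, $w_1=2.121820474+1.198476681\,i$, $w_2=\overline{w_1}$,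 one has $$\kappa_0\le\kappa(\Omega_0)\le\frac{h_{\Omega_0}(E)}{J_{\Omega_0}(E)}<0.4251605.$$ -/

import Mathlib

open Set MeasureTheory
open scoped ENNReal

noncomputable section

/-- `f` restricts to a holomorphic covering map of the unit disk `𝔻` onto `Ω`
(a holomorphic universal covering, since `𝔻` is simply connected). -/
structure IsHolomorphicDiskCovering (f : ℂ → ℂ) (Ω : Set ℂ) : Prop where
  differentiableOn : DifferentiableOn ℂ f (Metric.ball 0 1)
  image_eq : f '' Metric.ball 0 1 = Ω
  isCoveringMap : ∀ h : MapsTo f (Metric.ball 0 1) Ω, IsCoveringMap h.restrict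

/-- The hyperbolic density `ρ_Ω` of Gaussian curvature `-1`. It is determined by
`ρ_Ω(f(w)) |f'(w)| = 2 / (1 - |w|²)` for a holomorphic universal covering `f : 𝔻 → Ω`.
By the Schwarz-Pick lemma the value at `z` is the same for all `f` and all `w` with `f w = z`,
so that, for a hyperbolic domain `Ω` and `z ∈ Ω`, this is the infimum of a one-element set. -/
def hyperbolicDensity (Ω : Set ℂ) (z : ℂ) : ℝ≥0∞ :=
  ⨅ (f : ℂ → ℂ) (_ : IsHolomorphicDiskCovering f Ω) (w : ℂ)
    (_ : w ∈ Metric.ball (0 : ℂ) 1) (_ : f w = z),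
    ENNReal.ofReal (2 / (1 - ‖w‖ ^ 2) / ‖deriv f w‖)

/-- The length of the curve `γ : [0,1] → Ω` with respect to `ρ_Ω(z)|dz|`. -/
def hyperbolicLength (Ω : Set ℂ) (γ : ℝ → ℂ) : ℝ≥0∞ :=
  ∫⁻ t in Icc (0 : ℝ) 1, hyperbolicDensity Ω (γ t) * ‖deriv γ t‖ₑ

/-- The hyperbolic distance `h_Ω(z₁, z₂)` induced by `ρ_Ω(z)|dz|`: the infimum of the lengths of
the `C¹` curves in `Ω` from `z₁` to `z₂`. -/
def hyperbolicDist (Ω : Set ℂ) (z₁ z₂ : ℂ) : ℝ≥0∞ :=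
  ⨅ (γ : ℝ → ℂ) (_ : ContDiffOn ℝ 1 γ (Icc 0 1)) (_ : MapsTo γ (Icc 0 1) Ω)
    (_ : γ 0 = z₁) (_ : γ 1 = z₂), hyperbolicLength Ω γ

/-- The hyperbolic diameter `h_Ω(E)`. -/
def hyperbolicDiam (Ω E : Set ℂ) : ℝ≥0∞ :=
  ⨆ (z₁ ∈ E) (z₂ ∈ E), hyperbolicDist Ω z₁ z₂

/-- The Euclidean distance `d(E, F)` between two nonempty sets. -/
def euclideanSetDist (E F : Set ℂ) : ℝ :=
  sInf (image2 dist E F)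

/-- The functional `J_Ω(E) = log (1 + d(E) / d(E, ∂Ω))`. -/
def distanceRatioFunctional (Ω E : Set ℂ) : ℝ :=
  Real.log (1 + Metric.diam E / euclideanSetDist E (frontier Ω))

/-- The quotient `h_Ω(E) / J_Ω(E)`. -/
def kappaQuotient (Ω E : Set ℂ) : ℝ≥0∞ :=
  hyperbolicDiam Ω E / ENNReal.ofReal (distanceRatioFunctional Ω E)

/-- The domain constant `κ(Ω)`, the infimum of `h_Ω(E) / J_Ω(E)` over the compact subsets `E`
of `Ω` with at least two points. -/
def kappa (Ω : Set ℂ) : ℝ≥0∞ :=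
  ⨅ (E : Set ℂ) (_ : IsCompact E) (_ : E ⊆ Ω) (_ : E.Nontrivial), kappaQuotient Ω E

/-- `κ₀`, the infimum of `κ(Ω)` over all simply connected proper subdomains `Ω` of `ℂ`. -/
def kappaZero : ℝ≥0∞ :=
  ⨅ (Ω : Set ℂ) (_ : IsOpen Ω) (_ : IsSimplyConnected Ω) (_ : Ω ≠ univ), kappa Ω

/-- The three-point set `{w₀, w₁, w₂}` with `w₀ = 1`, `w₁ = 2.121820474 + 1.198476681 i`,
`w₂ = conj w₁`. -/
def threePointSet : Set ℂ :=
  {1, ⟨2.121820474, 1.198476681⟩, ⟨2.121820474, -1.198476681⟩}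

end

/-!
Both bounds of the corollary come from comparing the hyperbolic density of a simply connected domain
`Ω` with explicit densities.

*Lower bound.* A holomorphic covering of `Ω` by the disk is a conformal map, since the identity of `Ω`
lifts through it (`IsHolomorphicDiskCovering.exists_leftInverse`). The Koebe quarter theorem
(`norm_deriv_mul_le_of_injOn_of_omit`) then says that the density at `z` is at least
`1 / (2 |z - c|)` for each `c ∉ Ω`, and integration along curves gives
`h_Ω(z₁, z₂) ≥ (1/2) log (1 + |z₁ - z₂| / |z₁ - c|)` (`ofReal_log_le_hyperbolicDist`). Applied to a
fixed `z₁ ∈ E` and all `z₂ ∈ E`, it bounds the diameter of `E` and yields `h_Ω(E) ≥ J_Ω(E) / 4`.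

The quarter theorem is reduced to the bound `|H'(0)| ≤ 1` for univalent `H` with `H(0) = 0` and
`H(z) H(w) ≠ 1` (`norm_deriv_le_one_of_mul_ne_one`). That bound is an area argument for the measure
`dA / |w|²`, which is invariant under `w ↦ 1 / w`: the images of the annulus `s < |z| < 1` under `H`
and `1 / H` are disjoint, each has area at least `2π log (1/s)`, and both lie in a round annulus of
area about `4π log (1 / (s |H'(0)|))`.

*Upper bound.* The slit plane is the image of the disk under a Möbius map onto the right half-plane
followed by squaring. Images of radii bound the distance of `ζ²` and `u²` by
`log ((1 + P) / (1 - P))` with `P = |u - ζ| / |u + conj ζ|` (`hyperbolicDist_slitPlane_le`). For the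
three-point set all `P` are below `0.254258`, the distance to the boundary is `1` and the diameter is
at least `2.396953362`; what is left is the numerical inequality `log_lt_mul_log`.
-/

open Metric Filter Topology Complex

/-! ### Coverings of simply connected domains -/

/-- A covering of a simply connected domain by the disk has a continuous inverse: the lift of the
identity of `Ω`. -/
theorem IsHolomorphicDiskCovering.exists_leftInverse {f : ℂ → ℂ} {Ω : Set ℂ}
    (hf : IsHolomorphicDiskCovering f Ω) (hΩ : IsOpen Ω) (hs : IsSimplyConnected Ω) :
    ∃ s : ℂ → ℂ, ContinuousOn s Ω ∧ ∀ z ∈ ball (0 : ℂ) 1, s (f z) = z := by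
  classical
  have hmaps : MapsTo f (ball 0 1) Ω := fun z hz => hf.image_eq ▸ mem_image_of_mem f hz
  have hcov := hf.isCoveringMap hmaps
  have := hs.simplyConnectedSpace
  have := hΩ.locallyPathConnectedSpace
  have : PreconnectedSpace (ball (0 : ℂ) 1) :=
    isPreconnected_iff_preconnectedSpace.1 (convex_ball (0 : ℂ) 1).isPreconnected
  let e₀ : ball (0 : ℂ) 1 := ⟨0, by simp⟩
  obtain ⟨F, ⟨hF₀, hF⟩, -⟩ := hcov.existsUnique_continuousMap_lifts
    (ContinuousMap.id Ω) (hmaps.restrict f _ _ e₀) e₀ rfl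
  have hFf : F ∘ hmaps.restrict f _ _ = id := by
    refine hcov.eq_of_comp_eq (F.continuous.comp hcov.continuous) continuous_id ?_ e₀ hF₀
    rw [← Function.comp_assoc, hF]
    rfl
  refine ⟨fun z => if hz : z ∈ Ω then (F ⟨z, hz⟩ : ℂ) else 0, ?_, fun z hz => ?_⟩
  · rw [continuousOn_iff_continuous_domRestrict]
    convert! continuous_subtype_val.comp F.continuous
    ext z
    simp
  · simp only [dif_pos (hmaps hz)]
    exact congrArg Subtype.val (congrFun hFf ⟨z, hz⟩)

theorem IsHolomorphicDiskCovering.injOn {f : ℂ → ℂ} {Ω : Set ℂ}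
    (hf : IsHolomorphicDiskCovering f Ω) (hΩ : IsOpen Ω) (hs : IsSimplyConnected Ω) :
    InjOn f (ball 0 1) := by
  obtain ⟨s, -, hs⟩ := hf.exists_leftInverse hΩ hs
  intro z hz w hw h
  rw [← hs z hz, h, hs w hw]

/-- The critical points of `f` are isolated, so the continuous inverse of `f` is holomorphic off a
discrete set, hence holomorphic; the chain rule then excludes critical points. -/
theorem IsHolomorphicDiskCovering.deriv_ne_zero {f : ℂ → ℂ} {Ω : Set ℂ}
    (hf : IsHolomorphicDiskCovering f Ω) (hΩ : IsOpen Ω) (hs : IsSimplyConnected Ω) {w : ℂ}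
    (hw : w ∈ ball (0 : ℂ) 1) : deriv f w ≠ 0 := by
  have hinj := hf.injOn hΩ hs
  obtain ⟨s, hsc, hsf⟩ := hf.exists_leftInverse hΩ hs
  have hmaps : MapsTo f (ball 0 1) Ω := fun z hz => hf.image_eq ▸ mem_image_of_mem f hz
  have hfs : ∀ y ∈ Ω, s y ∈ ball (0 : ℂ) 1 ∧ f (s y) = y := by
    intro y hy
    rw [← hf.image_eq] at hy
    obtain ⟨z, hz, rfl⟩ := hy
    rw [hsf z hz]
    exact ⟨hz, rfl⟩
  have hnhds : ∀ z ∈ ball (0 : ℂ) 1, ball (0 : ℂ) 1 ∈ 𝓝 z := fun z hz => isOpen_ball.mem_nhds hz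
  have hdiff : ∀ z ∈ ball (0 : ℂ) 1, DifferentiableAt ℂ f z := fun z hz =>
    hf.differentiableOn.differentiableAt (hnhds z hz)
  have hcrit : ∀ᶠ z in 𝓝[≠] w, deriv f z ≠ 0 := by
    have han : AnalyticOnNhd ℂ (deriv f) (ball 0 1) :=
      (hf.differentiableOn.analyticOnNhd isOpen_ball).deriv
    rcases (han w hw).eventually_eq_zero_or_eventually_ne_zero with h | h
    · exfalso
      have h0 := han.eqOn_zero_of_preconnected_of_eventuallyEq_zero
        (convex_ball (0 : ℂ) 1).isPreconnected hw h
      have hconst : f (1 / 2) = f 0 := by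
        refine isOpen_ball.is_const_of_deriv_eq_zero (convex_ball (0 : ℂ) 1).isPreconnected
          hf.differentiableOn h0 ?_ ?_ <;> norm_num
      have := hinj (by norm_num) (by norm_num) hconst
      norm_num at this
    · exact h
  have hsw : Tendsto s (𝓝[≠] (f w)) (𝓝[≠] w) := by
    refine tendsto_nhdsWithin_iff.2 ⟨?_, ?_⟩
    · have := (hsc.continuousAt (hΩ.mem_nhds (hmaps hw))).tendsto
      rw [hsf w hw] at this
      exact this.mono_left nhdsWithin_le_nhds
    · filter_upwards [self_mem_nhdsWithin, nhdsWithin_le_nhds (hΩ.mem_nhds (hmaps hw))]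
        with y hy hyΩ h
      exact hy (by rw [mem_singleton_iff, ← (hfs y hyΩ).2, h])
  have hd : ∀ᶠ y in 𝓝[≠] (f w), DifferentiableAt ℂ s y := by
    filter_upwards [hsw.eventually hcrit, nhdsWithin_le_nhds (hΩ.mem_nhds (hmaps hw))] with y hy hyΩ
    refine (HasDerivAt.of_local_left_inverse (hsc.continuousAt (hΩ.mem_nhds hyΩ))
      (hdiff _ (hfs y hyΩ).1).hasDerivAt hy ?_).differentiableAt
    filter_upwards [hΩ.mem_nhds hyΩ] with x hx using (hfs x hx).2
  have hsd : DifferentiableAt ℂ s (f w) :=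
    (analyticAt_of_differentiable_on_punctured_nhds_of_continuousAt hd
      (hsc.continuousAt (hΩ.mem_nhds (hmaps hw)))).differentiableAt
  have hcomp : HasDerivAt (s ∘ f) (deriv s (f w) * deriv f w) w :=
    hsd.hasDerivAt.comp w (hdiff w hw).hasDerivAt
  have hid : HasDerivAt (s ∘ f) 1 w :=
    (hasDerivAt_id w).congr_of_eventuallyEq
      (by filter_upwards [hnhds w hw] with z hz using hsf z hz)
  intro h0
  simpa [h0] using hcomp.unique hid

/-! ### The logarithmic area of univalent images -/

/-- If `‖f‖ ≥ m` on the circle of radius `s` and `f 0 = 0`, then `f` takes in the disk every value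
of modulus less than `m`: if `w` were omitted, `q = f / (f - w)` would be holomorphic with positive
real part on the circle and `q 0 = 0`, against the maximum principle for `exp (-q)`. -/
theorem exists_eq_of_norm_lt_of_le_norm_sphere {f : ℂ → ℂ} {s m : ℝ} (hs : 0 < s)
    (hf : DiffContOnCl ℂ f (ball 0 s)) (h0 : f 0 = 0) (hm : ∀ z ∈ sphere (0 : ℂ) s, m ≤ ‖f z‖)
    {w : ℂ} (hw : ‖w‖ < m) : ∃ z ∈ closedBall (0 : ℂ) s, f z = w := by
  by_contra! hne
  have hcl : closure (ball (0 : ℂ) s) = closedBall 0 s := closure_ball _ hs.ne'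
  have hq : DiffContOnCl ℂ (fun z => cexp (-(f z * (f z - w)⁻¹))) (ball 0 s) := by
    have hinv : DiffContOnCl ℂ (fun z => f z - w)⁻¹ (ball 0 s) :=
      DiffContOnCl.inv (hf.sub_const w) fun z hz => sub_ne_zero.2 (hne z (hcl ▸ hz))
    exact (Complex.differentiable_exp (𝕜 := ℂ)).comp_diffContOnCl (hf.smul hinv).neg
  have hmax : ∃ z ∈ sphere (0 : ℂ) s, ∀ y ∈ sphere (0 : ℂ) s,
      ‖cexp (-(f y * (f y - w)⁻¹))‖ ≤ ‖cexp (-(f z * (f z - w)⁻¹))‖ := by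
    have := (isCompact_sphere (0 : ℂ) s).exists_isMaxOn
      (f := fun z => ‖cexp (-(f z * (f z - w)⁻¹))‖) ((NormedSpace.sphere_nonempty).2 hs.le) ?_
    · simpa only [isMaxOn_iff] using this
    exact (hq.continuousOn.mono (hcl ▸ sphere_subset_closedBall)).norm
  obtain ⟨z, hz, hzmax⟩ := hmax
  have h1 := Complex.norm_le_of_forall_mem_frontier_norm_le isBounded_ball hq
    (C := ‖cexp (-(f z * (f z - w)⁻¹))‖)
    (fun y hy => hzmax y (by rwa [frontier_ball _ hs.ne'] at hy))
    (subset_closure (mem_ball_self hs))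
  have hpos : 0 < (f z * (f z - w)⁻¹).re := by
    have hfz : ‖w‖ < ‖f z‖ := hw.trans_le (hm z hz)
    have hne' : f z - w ≠ 0 := sub_ne_zero.2 (hne z (sphere_subset_closedBall hz))
    have h2 : (f z * (f z - w)⁻¹).re
        = (‖f z‖ ^ 2 - (f z * (starRingEnd ℂ) w).re) / normSq (f z - w) := by
      rw [Complex.inv_def, ← mul_assoc, Complex.re_mul_ofReal, map_sub, mul_sub, Complex.mul_conj,
        Complex.sub_re, Complex.ofReal_re, Complex.normSq_eq_norm_sq, div_eq_mul_inv]
    rw [h2]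
    refine div_pos ?_ (normSq_pos.2 hne')
    have h3 : (f z * (starRingEnd ℂ) w).re ≤ ‖f z‖ * ‖w‖ := by
      refine (Complex.re_le_norm _).trans ?_
      rw [norm_mul, Complex.norm_conj]
    nlinarith [norm_nonneg w]
  rw [Complex.norm_exp, Complex.norm_exp, Real.exp_le_exp, h0] at h1
  simp only [zero_mul, neg_zero, zero_re, Complex.neg_re] at h1
  linarith

/-- The annulus `r < |z| < R` in polar coordinates. -/
theorem setLIntegral_annulus_eq_polar {r R : ℝ} (hr : 0 ≤ r) (F : ℂ → ℝ≥0∞) :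
    ∫⁻ z in {z : ℂ | ‖z‖ ∈ Ioo r R}, F z = ∫⁻ p in Ioo r R ×ˢ Ioo (-Real.pi) Real.pi,
      ENNReal.ofReal p.1 * F (Complex.polarCoord.symm p) := by
  have hA : MeasurableSet {z : ℂ | ‖z‖ ∈ Ioo r R} := measurable_norm measurableSet_Ioo
  rw [← lintegral_indicator hA, ← Complex.lintegral_comp_polarCoord_symm,
    ← lintegral_indicator polarCoord.open_target.measurableSet,
    ← lintegral_indicator (measurableSet_Ioo.prod measurableSet_Ioo)]
  congr 1
  ext p
  simp only [indicator, polarCoord_target, mem_ofPred_eq, Complex.norm_polarCoord_symm, smul_eq_mul,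
    mem_prod, mem_Ioo, mem_Ioi]
  by_cases h1 : 0 < p.1
  · rw [abs_of_pos h1]
    by_cases h2 : -Real.pi < p.2 ∧ p.2 < Real.pi <;> simp [h1, h2]
  · have : ¬ (r < p.1) := fun h => h1 (hr.trans_lt h)
    simp [h1, this]

/-- `∫ dr / r` as a lower Lebesgue integral. -/
theorem lintegral_Ioo_inv {a b : ℝ} (ha : 0 < a) (hab : a ≤ b) {c : ℝ} (hc : 0 ≤ c) :
    ∫⁻ r in Ioo a b, ENNReal.ofReal (c / r) = ENNReal.ofReal (c * Real.log (b / a)) := by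
  have hint : IntervalIntegrable (fun r : ℝ => c / r) volume a b := by
    refine ContinuousOn.intervalIntegrable ?_
    rw [uIcc_of_le hab]
    exact continuousOn_const.div continuousOn_id fun x hx => (ha.trans_le hx.1).ne'
  have h1 : c * Real.log (b / a) = ∫ r in a..b, c / r := by
    simp_rw [div_eq_mul_inv c]
    rw [intervalIntegral.integral_const_mul, integral_inv_of_pos ha (ha.trans_le hab)]
  rw [h1, intervalIntegral.integral_of_le hab, integral_Ioc_eq_integral_Ioo,
    ofReal_integral_eq_lintegral_ofReal]
  · exact (hint.1).mono_set Ioo_subset_Ioc_self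
  · filter_upwards [ae_restrict_mem measurableSet_Ioo] with r hr
    exact div_nonneg hc (ha.trans hr.1).le

/-- The logarithmic area of a round annulus. -/
theorem setLIntegral_annulus_inv_sq {m M : ℝ} (hm : 0 < m) (hM : m ≤ M) :
    ∫⁻ w in {w : ℂ | ‖w‖ ∈ Ioo m M}, ENNReal.ofReal (1 / ‖w‖ ^ 2)
      = ENNReal.ofReal (2 * Real.pi * Real.log (M / m)) := by
  rw [setLIntegral_annulus_eq_polar hm.le, Measure.volume_eq_prod,
    ← Measure.prod_restrict, lintegral_prod]
  · rw [← lintegral_Ioo_inv hm hM (by positivity)]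
    refine setLIntegral_congr_fun measurableSet_Ioo fun r hr => ?_
    have hr0 : 0 < r := hm.trans hr.1
    simp only [Complex.norm_polarCoord_symm, lintegral_const, Measure.restrict_apply_univ,
      Real.volume_Ioo, abs_of_pos hr0]
    rw [← ENNReal.ofReal_mul hr0.le, ← ENNReal.ofReal_mul (by positivity)]
    congr 1
    field_simp
    ring
  · simp only [Complex.norm_polarCoord_symm]
    fun_prop

/-- If `u` is holomorphic with `u 0 = 1`, its mean square over every circle is at least `1`. -/
theorem two_pi_le_lintegral_circle_norm_sq {u : ℂ → ℂ} (hu : DifferentiableOn ℂ u (ball 0 1))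
    (h0 : u 0 = 1) {r : ℝ} (hr : 0 < r) (hr1 : r < 1) {c : ℝ} (hc : 0 ≤ c) :
    ENNReal.ofReal (2 * Real.pi * c) ≤ ∫⁻ θ in Ioo (-Real.pi) Real.pi,
      ENNReal.ofReal (c * ‖u (Complex.polarCoord.symm (r, θ))‖ ^ 2) := by
  have hp : ∀ θ : ℝ, Complex.polarCoord.symm (r, θ) = circleMap 0 r θ := by
    intro θ
    rw [Complex.polarCoord_symm_apply, circleMap_zero, Complex.exp_mul_I]
    push_cast
    ring
  simp_rw [hp]
  have hball : ∀ θ : ℝ, circleMap 0 r θ ∈ ball (0 : ℂ) 1 := fun θ => by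
    simp [abs_of_pos hr, hr1]
  have hcont : Continuous fun θ : ℝ => u (circleMap 0 r θ) :=
    hu.continuousOn.comp_continuous (continuous_circleMap 0 r) hball
  have hmean : ∫ θ in (-Real.pi)..Real.pi, (u (circleMap 0 r θ)).re = 2 * Real.pi := by
    have hd : DiffContOnCl ℂ u (ball 0 |r|) := by
      rw [abs_of_pos hr]
      refine DifferentiableOn.diffContOnCl (hu.mono ?_)
      rw [closure_ball _ hr.ne']
      exact closedBall_subset_ball hr1
    have h1 := hd.circleAverage
    rw [Real.circleAverage, h0, inv_smul_eq_iff₀ (by positivity)] at h1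
    have hper : Function.Periodic (fun θ : ℝ => u (circleMap 0 r θ)) (2 * Real.pi) :=
      (periodic_circleMap 0 r).comp u
    have h2 := hper.intervalIntegral_add_eq (-Real.pi) 0
    rw [zero_add, h1, show -Real.pi + 2 * Real.pi = Real.pi by ring] at h2
    have h3 := intervalIntegral.intervalIntegral_re (𝕜 := ℂ)
      (hcont.intervalIntegrable (μ := volume) (-Real.pi) Real.pi)
    simp only [RCLike.re_eq_complex_re] at h3
    rw [h3, h2]
    simp
  have hpi : -Real.pi ≤ Real.pi := by linarith [Real.pi_pos]
  have hc1 : Continuous fun θ : ℝ => c * ‖u (circleMap 0 r θ)‖ ^ 2 :=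
    continuous_const.mul (hcont.norm.pow 2)
  have hre : Continuous fun θ : ℝ => 2 * (u (circleMap 0 r θ)).re :=
    continuous_const.mul (Complex.continuous_re.comp hcont)
  have hc2 : Continuous fun θ : ℝ => c * (2 * (u (circleMap 0 r θ)).re - 1) :=
    continuous_const.mul (hre.sub continuous_const)
  rw [← ofReal_integral_eq_lintegral_ofReal, ← integral_Ioc_eq_integral_Ioo,
    ← intervalIntegral.integral_of_le hpi]
  · refine ENNReal.ofReal_le_ofReal ?_
    calc 2 * Real.pi * c = ∫ θ in (-Real.pi)..Real.pi, c * (2 * (u (circleMap 0 r θ)).re - 1) := by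
          rw [intervalIntegral.integral_const_mul, intervalIntegral.integral_sub,
            intervalIntegral.integral_const_mul, hmean]
          · simp
            ring
          · exact hre.intervalIntegrable _ _
          · exact Continuous.intervalIntegrable (by fun_prop) _ _
      _ ≤ _ := by
          refine intervalIntegral.integral_mono_on hpi (hc2.intervalIntegrable _ _)
            (hc1.intervalIntegrable _ _) fun θ _ => mul_le_mul_of_nonneg_left ?_ hc
          have := Complex.re_le_norm (u (circleMap 0 r θ))
          nlinarith [sq_nonneg (‖u (circleMap 0 r θ)‖ - 1)]
  · exact (hc1.integrableOn_Icc).mono_set Ioo_subset_Icc_self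
  · exact ae_of_all _ fun θ => by positivity

/-- Here `u z / z` stands for the logarithmic derivative of a holomorphic function with a simple zero
at the origin and no other zeros. -/
theorem log_le_lintegral_annulus {u : ℂ → ℂ} (hu : DifferentiableOn ℂ u (ball 0 1))
    (h0 : u 0 = 1) {s : ℝ} (hs : 0 < s) (hs1 : s < 1) :
    ENNReal.ofReal (2 * Real.pi * Real.log (1 / s)) ≤
      ∫⁻ z in {z : ℂ | ‖z‖ ∈ Ioo s 1}, ENNReal.ofReal (‖u z‖ ^ 2 / ‖z‖ ^ 2) := by
  rw [setLIntegral_annulus_eq_polar hs.le, Measure.volume_eq_prod,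
    ← Measure.prod_restrict, lintegral_prod]
  · rw [← lintegral_Ioo_inv hs hs1.le (by positivity)]
    refine setLIntegral_mono' measurableSet_Ioo fun r hr => ?_
    have hr0 : 0 < r := hs.trans hr.1
    have h := two_pi_le_lintegral_circle_norm_sq hu h0 hr0 hr.2 (c := 1 / r) (by positivity)
    rw [mul_one_div] at h
    refine h.trans (le_of_eq ?_)
    refine lintegral_congr fun θ => ?_
    rw [← ENNReal.ofReal_mul hr0.le, Complex.norm_polarCoord_symm, abs_of_pos hr0]
    congr 1
    field_simp
  · rw [Measure.prod_restrict]
    refine ContinuousOn.aemeasurable ?_ (measurableSet_Ioo.prod measurableSet_Ioo)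
    have hc : Continuous fun p : ℝ × ℝ => Complex.polarCoord.symm p := by
      simp_rw [Complex.polarCoord_symm_apply]
      fun_prop
    have hpos : ∀ p ∈ Ioo s 1 ×ˢ Ioo (-Real.pi) Real.pi, 0 < p.1 := fun p hp => hs.trans hp.1.1
    have hu' : ContinuousOn (fun p : ℝ × ℝ => u (Complex.polarCoord.symm p))
        (Ioo s 1 ×ˢ Ioo (-Real.pi) Real.pi) := by
      refine hu.continuousOn.comp hc.continuousOn fun p hp => ?_
      rw [mem_ball_zero_iff, Complex.norm_polarCoord_symm, abs_of_pos (hpos p hp)]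
      exact hp.1.2
    have h1 : ContinuousOn (fun p : ℝ × ℝ => p.1 *
        (‖u (Complex.polarCoord.symm p)‖ ^ 2 / ‖Complex.polarCoord.symm p‖ ^ 2))
        (Ioo s 1 ×ˢ Ioo (-Real.pi) Real.pi) := by
      refine continuousOn_fst.mul ((hu'.norm.pow 2).div (hc.norm.pow 2).continuousOn ?_)
      intro p hp
      rw [Complex.norm_polarCoord_symm, abs_of_pos (hpos p hp)]
      exact pow_ne_zero _ (hpos p hp).ne'
    refine (ENNReal.continuous_ofReal.comp_continuousOn h1).congr fun p hp => ?_
    rw [Function.comp_apply, ← ENNReal.ofReal_mul (hpos p hp).le]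

/-- Change of variables for the logarithmic area `dA / |w|²` under an injective holomorphic map. -/
theorem lintegral_inv_sq_image {g g' : ℂ → ℂ} {A : Set ℂ} (hA : MeasurableSet A)
    (hg : ∀ z ∈ A, HasDerivAt g (g' z) z) (hinj : InjOn g A) :
    ∫⁻ w in g '' A, ENNReal.ofReal (1 / ‖w‖ ^ 2)
      = ∫⁻ z in A, ENNReal.ofReal (‖g' z‖ ^ 2 / ‖g z‖ ^ 2) := by
  rw [lintegral_image_eq_lintegral_abs_det_fderiv_mul volume hA
    (fun z hz => ((hg z hz).hasFDerivAt.restrictScalars ℝ).hasFDerivWithinAt) hinj]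
  refine setLIntegral_congr_fun hA fun z _ => ?_
  have hdet : ((ContinuousLinearMap.toSpanSingleton ℂ (g' z)).restrictScalars ℝ).det
      = ‖g' z‖ ^ 2 := by
    simp [ContinuousLinearMap.det, LinearMap.det_restrictScalars, Algebra.norm_complex_eq,
      Complex.normSq_eq_norm_sq]
  simp only [hdet]
  rw [← ENNReal.ofReal_mul (abs_nonneg _), abs_of_nonneg (by positivity), mul_one_div]

/-! ### The Koebe quarter theorem -/

/-- Area comparison for a univalent function `H` with `H 0 = 0` and `H z * H w ≠ 1`: it cannot
exceed `s` in modulus all along the circle of radius `s`. The images of `s < |z| < 1` under `H` and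
`1 / H` are disjoint, they have the same logarithmic area, at least `2π log (1/s)`, and both lie in
`m < |w| < 1/m` if `|H| > m` on the circle. -/
theorem exists_norm_le_of_mul_ne_one {H : ℂ → ℂ} (hH : DifferentiableOn ℂ H (ball 0 1))
    (hinj : InjOn H (ball 0 1)) (h0 : H 0 = 0)
    (hmul : ∀ z ∈ ball (0 : ℂ) 1, ∀ w ∈ ball (0 : ℂ) 1, H z * H w ≠ 1)
    (hd0 : deriv H 0 ≠ 0) {s : ℝ} (hs : 0 < s) (hs1 : s < 1) :
    ∃ z ∈ sphere (0 : ℂ) s, ‖H z‖ ≤ s := by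
  by_contra! hgt
  have hsub : closedBall (0 : ℂ) s ⊆ ball 0 1 := closedBall_subset_ball hs1
  have h0mem : (0 : ℂ) ∈ ball (0 : ℂ) 1 := mem_ball_self one_pos
  have hne0 : ∀ z ∈ ball (0 : ℂ) 1, z ≠ 0 → H z ≠ 0 := fun z hz hz0 h =>
    hz0 (hinj hz h0mem (h.trans h0.symm))
  have hnhds : ∀ z ∈ ball (0 : ℂ) 1, ball (0 : ℂ) 1 ∈ 𝓝 z := fun z hz => isOpen_ball.mem_nhds hz
  have hcl : DiffContOnCl ℂ H (ball 0 s) := by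
    refine DifferentiableOn.diffContOnCl (hH.mono ?_)
    rwa [closure_ball _ hs.ne']
  obtain ⟨z₀, hz₀, hmin⟩ := (isCompact_sphere (0 : ℂ) s).exists_isMinOn
    ((NormedSpace.sphere_nonempty).2 hs.le)
    (hH.continuousOn.mono (sphere_subset_closedBall.trans hsub)).norm
  rw [isMinOn_iff] at hmin
  have hcover : ∀ w : ℂ, ‖w‖ < ‖H z₀‖ → ∃ z ∈ closedBall (0 : ℂ) s, H z = w := fun w hw =>
    exists_eq_of_norm_lt_of_le_norm_sphere hs hcl h0 hmin hw
  obtain ⟨m, hsm, hm⟩ := exists_between (lt_min (hgt z₀ hz₀) hs1)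
  have hmz : m < ‖H z₀‖ := hm.trans_le (min_le_left _ _)
  have hm1 : m < 1 := hm.trans_le (min_le_right _ _)
  have hm0 : 0 < m := hs.trans hsm
  set A : Set ℂ := {z : ℂ | ‖z‖ ∈ Ioo s 1} with hAdef
  have hA : MeasurableSet A := measurable_norm measurableSet_Ioo
  have hAball : ∀ z ∈ A, z ∈ ball (0 : ℂ) 1 := fun z hz => by simpa using hz.2
  have hA0 : ∀ z ∈ A, z ≠ 0 := fun z hz => norm_pos_iff.1 (hs.trans hz.1)
  have hgtm : ∀ z ∈ A, m < ‖H z‖ := by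
    intro z hz
    by_contra! hle
    obtain ⟨z', hz', he⟩ := hcover (H z) (hle.trans_lt hmz)
    rw [hinj (hsub hz') (hAball z hz) he, mem_closedBall_zero_iff] at hz'
    exact absurd hz.1 hz'.not_gt
  have hltm : ∀ z ∈ A, ‖H z‖ < 1 / m := by
    intro z hz
    by_contra! hle
    have hHz := hne0 z (hAball z hz) (hA0 z hz)
    obtain ⟨z', hz', he⟩ := hcover (H z)⁻¹ (by
      rw [norm_inv]
      refine lt_of_le_of_lt ?_ hmz
      rw [one_div] at hle
      exact inv_le_of_inv_le₀ hm0 hle)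
    exact hmul z (hAball z hz) z' (hsub hz') (by rw [he, mul_inv_cancel₀ hHz])
  have hder : ∀ z ∈ A, HasDerivAt H (deriv H z) z := fun z hz =>
    (hH.differentiableAt (hnhds z (hAball z hz))).hasDerivAt
  have hder' : ∀ z ∈ A, HasDerivAt (fun z => (H z)⁻¹) (-deriv H z / H z ^ 2) z := fun z hz =>
    (hder z hz).fun_inv (hne0 z (hAball z hz) (hA0 z hz))
  have hinjA : InjOn H A := hinj.mono hAball
  have hI1 := lintegral_inv_sq_image hA hder hinjA
  have hI2 := lintegral_inv_sq_image hA hder' (fun z hz w hw h => hinjA hz hw (inv_injective h))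
  have hI3 : ∫⁻ z in A, ENNReal.ofReal (‖-deriv H z / H z ^ 2‖ ^ 2 / ‖(H z)⁻¹‖ ^ 2)
      = ∫⁻ z in A, ENNReal.ofReal (‖deriv H z‖ ^ 2 / ‖H z‖ ^ 2) := by
    refine setLIntegral_congr_fun hA fun z hz => ?_
    have : ‖H z‖ ≠ 0 := norm_ne_zero_iff.2 (hne0 z (hAball z hz) (hA0 z hz))
    simp only [norm_div, norm_neg, norm_pow, norm_inv]
    congr 1
    field_simp
  have hlow : ENNReal.ofReal (2 * Real.pi * Real.log (1 / s)) ≤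
      ∫⁻ z in A, ENNReal.ofReal (‖deriv H z‖ ^ 2 / ‖H z‖ ^ 2) := by
    have hds : DifferentiableOn ℂ (dslope H 0) (ball 0 1) :=
      (Complex.differentiableOn_dslope (hnhds 0 h0mem)).2 hH
    have hfac : ∀ z, H z = z * dslope H 0 z := fun z => by
      simpa [h0] using (sub_smul_dslope H 0 z).symm
    have hdsne : ∀ z ∈ ball (0 : ℂ) 1, dslope H 0 z ≠ 0 := by
      intro z hz h
      by_cases hz0 : z = 0
      · rw [hz0, dslope_same] at h
        exact hd0 h
      · exact hne0 z hz hz0 (by rw [hfac, h, mul_zero])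
    have hu : DifferentiableOn ℂ (fun z => deriv H z / dslope H 0 z) (ball 0 1) :=
      (hH.deriv isOpen_ball).div hds hdsne
    refine (log_le_lintegral_annulus hu (by simp [dslope_same, hd0]) hs hs1).trans (le_of_eq ?_)
    refine setLIntegral_congr_fun hA fun z _ => ?_
    rw [hfac z, norm_mul, norm_div, div_pow, div_div, mul_pow, mul_comm (‖z‖ ^ 2)]
  have hdisj : Disjoint (H '' A) ((fun z => (H z)⁻¹) '' A) := by
    rw [Set.disjoint_left]
    rintro _ ⟨z, hz, rfl⟩ ⟨w, hw, h⟩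
    refine hmul z (hAball z hz) w (hAball w hw) ?_
    simp only at h
    rw [← h, inv_mul_cancel₀ (hne0 w (hAball w hw) (hA0 w hw))]
  have hmeas : MeasurableSet ((fun z => (H z)⁻¹) '' A) :=
    measurable_image_of_fderivWithin hA (fun z hz => ((hder' z hz).hasFDerivAt.restrictScalars ℝ).hasFDerivWithinAt)
      (fun z hz w hw h => hinjA hz hw (inv_injective h))
  have hunion : H '' A ∪ (fun z => (H z)⁻¹) '' A ⊆ {w : ℂ | ‖w‖ ∈ Ioo m (1 / m)} := by
    rintro _ (⟨z, hz, rfl⟩ | ⟨z, hz, rfl⟩)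
    · exact ⟨hgtm z hz, hltm z hz⟩
    · have h1 := hgtm z hz
      have h2 := hltm z hz
      have h3 : 0 < ‖H z‖ := hm0.trans h1
      refine ⟨?_, ?_⟩
      · rw [norm_inv, lt_inv_comm₀ hm0 h3, ← one_div]
        exact h2
      · rw [norm_inv, one_div]
        exact inv_strictAnti₀ hm0 h1
  have hfinal : ENNReal.ofReal (2 * Real.pi * Real.log (1 / s))
      + ENNReal.ofReal (2 * Real.pi * Real.log (1 / s))
      ≤ ENNReal.ofReal (2 * Real.pi * Real.log (1 / m / m)) := by
    rw [← setLIntegral_annulus_inv_sq hm0 (by rw [le_div_iff₀ hm0]; nlinarith)]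
    calc _ ≤ ∫⁻ w in H '' A ∪ (fun z => (H z)⁻¹) '' A, ENNReal.ofReal (1 / ‖w‖ ^ 2) := by
          rw [lintegral_union hmeas hdisj, hI1, hI2, hI3]
          exact add_le_add hlow hlow
      _ ≤ _ := lintegral_mono_set hunion
  have hlogs : 0 ≤ Real.log (1 / s) := Real.log_nonneg (by rw [le_div_iff₀ hs]; linarith)
  have hlogm : 0 ≤ Real.log (1 / m) := Real.log_nonneg (by rw [le_div_iff₀ hm0]; linarith)
  have hlog2 : Real.log (1 / m / m) = 2 * Real.log (1 / m) := by
    rw [div_eq_mul_one_div (1 / m) m, Real.log_mul (by positivity) (by positivity)]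
    ring
  rw [← ENNReal.ofReal_add (by positivity) (by positivity), hlog2,
    ENNReal.ofReal_le_ofReal_iff (by positivity)] at hfinal
  have hle : Real.log (1 / s) ≤ Real.log (1 / m) := by
    have := Real.pi_pos
    nlinarith
  rw [one_div, one_div, Real.log_inv, Real.log_inv, neg_le_neg_iff,
    Real.log_le_log_iff hm0 hs] at hle
  exact absurd hsm hle.not_gt

/-- Univalent Bieberbach–Eilenberg functions have derivative at most `1` at the origin. -/
theorem norm_deriv_le_one_of_mul_ne_one {H : ℂ → ℂ} (hH : DifferentiableOn ℂ H (ball 0 1))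
    (hinj : InjOn H (ball 0 1)) (h0 : H 0 = 0)
    (hmul : ∀ z ∈ ball (0 : ℂ) 1, ∀ w ∈ ball (0 : ℂ) 1, H z * H w ≠ 1) :
    ‖deriv H 0‖ ≤ 1 := by
  by_contra! hgt
  have hd0 : deriv H 0 ≠ 0 := norm_pos_iff.1 (one_pos.trans hgt)
  have hH0 : DifferentiableAt ℂ H 0 := hH.differentiableAt (isOpen_ball.mem_nhds (by simp))
  have hev : ∀ᶠ z in 𝓝 (0 : ℂ), 1 < ‖dslope H 0 z‖ := by
    have hc : ContinuousAt (dslope H 0) 0 := continuousAt_dslope_same.2 hH0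
    refine hc.norm.eventually (lt_mem_nhds ?_)
    simpa only [dslope_same] using hgt
  obtain ⟨ε, hε, hball⟩ := Metric.eventually_nhds_iff_ball.1 hev
  have hs : 0 < min (ε / 2) (1 / 2) := by positivity
  obtain ⟨z, hz, hle⟩ := exists_norm_le_of_mul_ne_one hH hinj h0 hmul hd0 hs
    ((min_le_right _ _).trans_lt (by norm_num))
  rw [mem_sphere_zero_iff_norm] at hz
  have h1 := hball z (by
    rw [mem_ball_zero_iff, hz]
    exact (min_le_left _ _).trans_lt (by linarith))
  have hfac : H z = z * dslope H 0 z := by simpa [h0] using (sub_smul_dslope H 0 z).symm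
  rw [hfac, norm_mul, hz] at hle
  nlinarith

/-- The Koebe quarter theorem. With the branch `G = √((f - c) / (f 0 - c))`, `G 0 = 1`, the ranges of `G` and `-G` are disjoint, so
`H = (G - 1) / (G + 1)` satisfies `H z * H w ≠ 1`, and `H' 0 = f' 0 / (4 (f 0 - c))`. -/
theorem norm_deriv_zero_le_of_injOn_of_omit {f : ℂ → ℂ} (hf : DifferentiableOn ℂ f (ball 0 1))
    (hinj : InjOn f (ball 0 1)) {c : ℂ} (hc : ∀ z ∈ ball (0 : ℂ) 1, f z ≠ c) :
    ‖deriv f 0‖ ≤ 4 * ‖f 0 - c‖ := by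
  have h0mem : (0 : ℂ) ∈ ball (0 : ℂ) 1 := mem_ball_self one_pos
  have hne : ∀ z ∈ ball (0 : ℂ) 1, f z - c ≠ 0 := fun z hz => sub_ne_zero.2 (hc z hz)
  have hfd : ∀ z ∈ ball (0 : ℂ) 1, HasDerivAt f (deriv f z) z := fun z hz =>
    (hf.differentiableAt (isOpen_ball.mem_nhds hz)).hasDerivAt
  obtain ⟨L, hL0, hL⟩ := (DifferentiableOn.isExactOn_ball
    ((hf.deriv isOpen_ball).div (hf.sub_const c) hne)).with_val_at 0 0
  have hexp : ∀ z ∈ ball (0 : ℂ) 1, cexp (L z) * (f 0 - c) = f z - c := by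
    have hk : ∀ z ∈ ball (0 : ℂ) 1, HasDerivAt (fun z => (f z - c) * cexp (-L z)) 0 z := by
      intro z hz
      have := ((hfd z hz).sub_const c).mul ((hL z hz).fun_neg.cexp)
      refine this.congr_deriv ?_
      simp only [Pi.div_apply]
      have := hne z hz
      field_simp
      ring
    intro z hz
    have hconst := isOpen_ball.is_const_of_deriv_eq_zero (convex_ball (0 : ℂ) 1).isPreconnected
      (fun z hz => (hk z hz).differentiableAt.differentiableWithinAt)
      (fun z hz => (hk z hz).deriv) hz h0mem
    simp only [hL0, neg_zero, Complex.exp_zero, mul_one] at hconst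
    rw [← hconst, Complex.exp_neg]
    have := Complex.exp_ne_zero (L z)
    field_simp
  have hf0 := hne 0 h0mem
  set G : ℂ → ℂ := fun z => cexp (L z / 2) with hGdef
  have hGsq : ∀ z, G z ^ 2 = cexp (L z) := fun z => by
    rw [hGdef, ← Complex.exp_nat_mul]
    congr 1
    push_cast
    ring
  have hG0 : G 0 = 1 := by simp [hGdef, hL0]
  have hGsq_inj : ∀ z ∈ ball (0 : ℂ) 1, ∀ w ∈ ball (0 : ℂ) 1, G z ^ 2 = G w ^ 2 → z = w := by
    intro z hz w hw h
    rw [hGsq, hGsq] at h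
    refine hinj hz hw ?_
    have := (hexp z hz).symm.trans ((congrArg (· * (f 0 - c)) h).trans (hexp w hw))
    exact sub_left_injective this
  have hGne : ∀ z, G z ≠ 0 := fun z => Complex.exp_ne_zero _
  have hGadd : ∀ z ∈ ball (0 : ℂ) 1, ∀ w ∈ ball (0 : ℂ) 1, G z + G w ≠ 0 := by
    intro z hz w hw h
    have hzw := hGsq_inj z hz w hw (by rw [eq_neg_of_add_eq_zero_left h, neg_sq])
    rw [hzw, ← two_mul] at h
    exact hGne w (by simpa using h)
  have hG1 : ∀ z ∈ ball (0 : ℂ) 1, G z + 1 ≠ 0 := fun z hz => hG0 ▸ hGadd z hz 0 h0mem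
  have hGd : ∀ z ∈ ball (0 : ℂ) 1,
      HasDerivAt G (G z * (deriv f z / (f z - c) / 2)) z := fun z hz =>
    ((hL z hz).div_const 2).cexp
  have hHd : ∀ z ∈ ball (0 : ℂ) 1, HasDerivAt (fun z => (G z - 1) / (G z + 1))
      ((G z * (deriv f z / (f z - c) / 2) * (G z + 1)
        - (G z - 1) * (G z * (deriv f z / (f z - c) / 2))) / (G z + 1) ^ 2) z := fun z hz =>
    ((hGd z hz).sub_const 1).fun_div ((hGd z hz).add_const 1) (hG1 z hz)
  have hmain := norm_deriv_le_one_of_mul_ne_one (H := fun z => (G z - 1) / (G z + 1))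
    (fun z hz => (hHd z hz).differentiableAt.differentiableWithinAt) ?_ (by simp [hG0]) ?_
  · rw [(hHd 0 h0mem).deriv, hG0] at hmain
    have he : ((1 : ℂ) * (deriv f 0 / (f 0 - c) / 2) * (1 + 1)
        - (1 - 1) * (1 * (deriv f 0 / (f 0 - c) / 2))) / (1 + 1) ^ 2
        = deriv f 0 / (4 * (f 0 - c)) := by
      field_simp
      ring
    rw [he, norm_div, norm_mul, Complex.norm_ofNat, div_le_one (by positivity)] at hmain
    exact hmain
  · intro z hz w hw h
    simp only at h
    rw [div_eq_div_iff (hG1 z hz) (hG1 w hw)] at h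
    refine hGsq_inj z hz w hw ?_
    rw [show G z = G w by linear_combination h / 2]
  · intro z hz w hw h
    rw [div_mul_div_comm, div_eq_one_iff_eq (mul_ne_zero (hG1 z hz) (hG1 w hw))] at h
    exact hGadd z hz w hw (by linear_combination -h / 2)

/-- The Koebe quarter theorem at an arbitrary point of the disk. -/
theorem norm_deriv_mul_le_of_injOn_of_omit {f : ℂ → ℂ} (hf : DifferentiableOn ℂ f (ball 0 1))
    (hinj : InjOn f (ball 0 1)) {c : ℂ} (hc : ∀ z ∈ ball (0 : ℂ) 1, f z ≠ c) {w : ℂ}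
    (hw : w ∈ ball (0 : ℂ) 1) : ‖deriv f w‖ * (1 - ‖w‖ ^ 2) ≤ 4 * ‖f w - c‖ := by
  rw [mem_ball_zero_iff] at hw
  have hden : ∀ z ∈ ball (0 : ℂ) 1, 1 + (starRingEnd ℂ) w * z ≠ 0 := by
    intro z hz h
    rw [mem_ball_zero_iff] at hz
    have h1 : ‖(starRingEnd ℂ) w * z‖ = 1 := by
      rw [eq_neg_of_add_eq_zero_right h, norm_neg, norm_one]
    rw [norm_mul, Complex.norm_conj] at h1
    nlinarith [norm_nonneg w, norm_nonneg z]
  have hd : ∀ z ∈ ball (0 : ℂ) 1, HasDerivAt (fun z => (z + w) / (1 + (starRingEnd ℂ) w * z))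
      ((1 * (1 + (starRingEnd ℂ) w * z) - (z + w) * ((starRingEnd ℂ) w * 1))
        / (1 + (starRingEnd ℂ) w * z) ^ 2) z := fun z hz =>
    ((hasDerivAt_id z).add_const w).fun_div
      (((hasDerivAt_id z).const_mul ((starRingEnd ℂ) w)).const_add 1) (hden z hz)
  have hmaps : MapsTo (fun z => (z + w) / (1 + (starRingEnd ℂ) w * z)) (ball 0 1) (ball 0 1) := by
    intro z hz
    have hdz := hden z hz
    rw [mem_ball_zero_iff] at hz
    rw [mem_ball_zero_iff, norm_div, div_lt_one (norm_pos_iff.2 hdz),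
      ← sq_lt_sq₀ (norm_nonneg _) (norm_nonneg _), ← Complex.normSq_eq_norm_sq,
      ← Complex.normSq_eq_norm_sq]
    have hz2 : normSq z < 1 := by
      rw [Complex.normSq_eq_norm_sq]; nlinarith [norm_nonneg z]
    have hw2 : normSq w < 1 := by
      rw [Complex.normSq_eq_norm_sq]; nlinarith [norm_nonneg w]
    rw [Complex.normSq_apply] at hz2 hw2 ⊢
    simp only [Complex.normSq_apply, Complex.add_re, Complex.add_im, Complex.mul_re,
      Complex.mul_im, Complex.conj_re, Complex.conj_im, Complex.one_re, Complex.one_im]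
    nlinarith [mul_pos (sub_pos.2 hz2) (sub_pos.2 hw2)]
  have h0mem : (0 : ℂ) ∈ ball (0 : ℂ) 1 := mem_ball_self one_pos
  have hwmem : w ∈ ball (0 : ℂ) 1 := by simpa using hw
  have hcomp := norm_deriv_zero_le_of_injOn_of_omit (c := c)
    (hf.comp (fun z hz => (hd z hz).differentiableAt.differentiableWithinAt) hmaps)
    (hinj.comp ?_ hmaps) (fun z hz => hc _ (hmaps hz))
  · have h1 : HasDerivAt (f ∘ fun z => (z + w) / (1 + (starRingEnd ℂ) w * z))
        (deriv f w * (1 - w * (starRingEnd ℂ) w)) 0 := by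
      have hfw : HasDerivAt f (deriv f w) ((0 + w) / (1 + (starRingEnd ℂ) w * 0)) := by
        simpa using (hf.differentiableAt (isOpen_ball.mem_nhds hwmem)).hasDerivAt
      have := hfw.comp (0 : ℂ) (hd 0 h0mem)
      simpa using this
    rw [h1.deriv, Complex.mul_conj, Complex.normSq_eq_norm_sq, norm_mul] at hcomp
    have h2 : ‖(1 : ℂ) - ((‖w‖ ^ 2 : ℝ) : ℂ)‖ = 1 - ‖w‖ ^ 2 := by
      rw [← Complex.ofReal_one, ← Complex.ofReal_sub, Complex.norm_real, Real.norm_of_nonneg]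
      nlinarith [norm_nonneg w]
    rw [h2] at hcomp
    simpa using hcomp
  · intro z hz z' hz' h
    simp only at h
    rw [div_eq_div_iff (hden z hz) (hden z' hz')] at h
    have h3 : (z - z') * (1 - w * (starRingEnd ℂ) w) = 0 := by linear_combination h
    rcases mul_eq_zero.1 h3 with h4 | h4
    · exact sub_eq_zero.1 h4
    · exfalso
      rw [Complex.mul_conj, Complex.normSq_eq_norm_sq, sub_eq_zero] at h4
      have h5 : (1 : ℝ) = ‖w‖ ^ 2 := by exact_mod_cast h4
      nlinarith [norm_nonneg w]

/-! ### Lower bounds for the hyperbolic distance -/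

/-- The hyperbolic density of a simply connected domain is at least `1 / (2 |z - c|)` for every
omitted value `c`. -/
theorem ofReal_inv_le_hyperbolicDensity {Ω : Set ℂ} (hΩ : IsOpen Ω) (hs : IsSimplyConnected Ω)
    {c : ℂ} (hc : c ∉ Ω) (z : ℂ) :
    ENNReal.ofReal (1 / (2 * ‖z - c‖)) ≤ hyperbolicDensity Ω z := by
  refine le_iInf fun f => le_iInf fun hf => le_iInf fun w => le_iInf fun hw => le_iInf fun hfw => ?_
  have homit : ∀ y ∈ ball (0 : ℂ) 1, f y ≠ c := by
    rintro y hy rfl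
    exact hc (hf.image_eq ▸ mem_image_of_mem f hy)
  have hkoebe := norm_deriv_mul_le_of_injOn_of_omit hf.differentiableOn (hf.injOn hΩ hs) homit hw
  have hpos : 0 < ‖deriv f w‖ := norm_pos_iff.2 (hf.deriv_ne_zero hΩ hs hw)
  have hzc : 0 < ‖f w - c‖ := norm_pos_iff.2 (sub_ne_zero.2 (homit w hw))
  rw [mem_ball_zero_iff] at hw
  have hw2 : 0 < 1 - ‖w‖ ^ 2 := by nlinarith [norm_nonneg w]
  refine ENNReal.ofReal_le_ofReal ?_
  rw [← hfw, div_div, div_le_div_iff₀ (by positivity) (by positivity)]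
  linarith

/-- A curve of Euclidean length `ℓ` from `a` stays within `|a - c| + ℓ` of `c`, so its length in the
metric `|dz| / (2 |z - c|)` is at least `∫ dℓ / (2 (|a - c| + ℓ))`. -/
theorem ofReal_log_le_hyperbolicLength {Ω : Set ℂ} (hΩ : IsOpen Ω) (hs : IsSimplyConnected Ω)
    {c : ℂ} (hc : c ∉ Ω) {γ : ℝ → ℂ} (hγ : ContDiffOn ℝ 1 γ (Icc 0 1))
    (hmaps : MapsTo γ (Icc 0 1) Ω) :
    ENNReal.ofReal (1 / 2 * Real.log (1 + ‖γ 1 - γ 0‖ / ‖γ 0 - c‖)) ≤ hyperbolicLength Ω γ := by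
  have h0 : γ 0 ∈ Ω := hmaps (by simp)
  set D := ‖γ 0 - c‖ with hD
  have hDpos : 0 < D := norm_pos_iff.2 (sub_ne_zero.2 (ne_of_mem_of_not_mem h0 hc))
  have hv : ContinuousOn (derivWithin γ (Icc 0 1)) (Icc 0 1) :=
    hγ.continuousOn_derivWithin (uniqueDiffOn_Icc one_pos) le_rfl
  set V : ℝ → ℝ := IccExtend (zero_le_one' ℝ) fun t : Icc (0 : ℝ) 1 => ‖derivWithin γ (Icc 0 1) t‖
    with hV
  have hVc : Continuous V :=
    (continuousOn_iff_continuous_domRestrict.1 hv).norm.Icc_extend'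
  have hVnn : ∀ t, 0 ≤ V t := fun t => norm_nonneg _
  have hVeq : ∀ t ∈ Ioo (0 : ℝ) 1, V t = ‖deriv γ t‖ := by
    intro t ht
    rw [hV, IccExtend_of_mem _ _ (Ioo_subset_Icc_self ht),
      derivWithin_of_mem_nhds (Icc_mem_nhds ht.1 ht.2)]
  set l : ℝ → ℝ := fun t => ∫ x in (0 : ℝ)..t, V x with hl
  have hld : ∀ t, HasDerivAt l (V t) t := fun t =>
    (hVc.integral_hasStrictDerivAt 0 t).hasDerivAt
  have hl0 : l 0 = 0 := intervalIntegral.integral_same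
  have hlnn : ∀ t, 0 ≤ t → 0 ≤ l t := fun t ht =>
    intervalIntegral.integral_nonneg ht fun x _ => hVnn x
  have hdist : ∀ t ∈ Icc (0 : ℝ) 1, ‖γ t - γ 0‖ ≤ l t := by
    refine image_norm_le_of_norm_deriv_right_le_deriv_boundary
      (f := fun t => γ t - γ 0) (f' := derivWithin γ (Icc 0 1)) (B' := V)
      (hγ.continuousOn.sub continuousOn_const) ?_ (by simp [hl0]) hld ?_
    · intro t ht
      have h1 := ((hγ.differentiableOn one_ne_zero t (Ico_subset_Icc_self ht)).hasDerivWithinAt).sub_const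
        (γ 0)
      exact h1.mono_of_mem_nhdsWithin (Icc_mem_nhdsGE_of_mem ht)
    · intro t ht
      rw [hV, IccExtend_of_mem _ _ (Ico_subset_Icc_self ht)]
  have hDl : ∀ t ∈ Icc (0 : ℝ) 1, 0 < D + l t := fun t ht => by linarith [hlnn t ht.1]
  have hlc : Continuous l := continuous_iff_continuousAt.2 fun t => (hld t).continuousAt
  have hquot : ContinuousOn (fun t => V t / (2 * (D + l t))) (Icc 0 1) :=
    hVc.continuousOn.div (by fun_prop) fun t ht => by linarith [hDl t ht]
  have hint : ∫ t in (0 : ℝ)..1, V t / (2 * (D + l t)) = 1 / 2 * Real.log (1 + l 1 / D) := by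
    have h1 := intervalIntegral.integral_eq_sub_of_hasDerivAt (a := 0) (b := 1)
      (f := fun t => 1 / 2 * Real.log (D + l t)) (f' := fun t => V t / (2 * (D + l t))) ?_ ?_
    · rw [h1, hl0, add_zero, ← mul_sub,
        ← Real.log_div (hDl 1 (by simp)).ne' hDpos.ne', add_div, div_self hDpos.ne']
    · intro t ht
      rw [uIcc_of_le zero_le_one] at ht
      refine ((((hld t).const_add D).log (hDl t ht).ne').const_mul (1 / 2)).congr_deriv ?_
      rw [div_mul_div_comm, one_mul]
    · refine ContinuousOn.intervalIntegrable ?_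
      rwa [uIcc_of_le zero_le_one]
  calc ENNReal.ofReal (1 / 2 * Real.log (1 + ‖γ 1 - γ 0‖ / D))
      ≤ ENNReal.ofReal (∫ t in (0 : ℝ)..1, V t / (2 * (D + l t))) := by
        rw [hint]
        refine ENNReal.ofReal_le_ofReal (mul_le_mul_of_nonneg_left ?_ (by norm_num))
        refine Real.log_le_log (by positivity) ?_
        have := hdist 1 (by simp)
        gcongr
    _ = ∫⁻ t in Ioo (0 : ℝ) 1, ENNReal.ofReal (V t / (2 * (D + l t))) := by
        rw [intervalIntegral.integral_of_le zero_le_one, integral_Ioc_eq_integral_Ioo,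
          ofReal_integral_eq_lintegral_ofReal]
        · exact hquot.integrableOn_Icc.mono_set Ioo_subset_Icc_self
        · filter_upwards [ae_restrict_mem measurableSet_Ioo] with t ht
          exact div_nonneg (hVnn t) (by linarith [hDl t (Ioo_subset_Icc_self ht)])
    _ ≤ ∫⁻ t in Ioo (0 : ℝ) 1, hyperbolicDensity Ω (γ t) * ‖deriv γ t‖ₑ := by
        refine setLIntegral_mono' measurableSet_Ioo fun t ht => ?_
        have htI := Ioo_subset_Icc_self ht
        rw [div_eq_mul_one_div, mul_comm, ENNReal.ofReal_mul (by
          have := hDl t htI; positivity), hVeq t ht, ofReal_norm]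
        gcongr
        refine le_trans (ENNReal.ofReal_le_ofReal ?_)
          (ofReal_inv_le_hyperbolicDensity hΩ hs hc (γ t))
        have hpos : 0 < ‖γ t - c‖ :=
          norm_pos_iff.2 (sub_ne_zero.2 (ne_of_mem_of_not_mem (hmaps htI) hc))
        have htri : ‖γ t - c‖ ≤ D + l t := by
          have h1 := norm_add_le (γ t - γ 0) (γ 0 - c)
          rw [sub_add_sub_cancel] at h1
          linarith [hdist t htI]
        gcongr
    _ ≤ hyperbolicLength Ω γ := lintegral_mono_set Ioo_subset_Icc_self

theorem ofReal_log_le_hyperbolicDist {Ω : Set ℂ} (hΩ : IsOpen Ω) (hs : IsSimplyConnected Ω)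
    {c : ℂ} (hc : c ∉ Ω) (z₁ z₂ : ℂ) :
    ENNReal.ofReal (1 / 2 * Real.log (1 + ‖z₂ - z₁‖ / ‖z₁ - c‖)) ≤ hyperbolicDist Ω z₁ z₂ := by
  refine le_iInf fun γ => le_iInf fun hγ => le_iInf fun hm => le_iInf fun h0 => le_iInf fun h1 => ?_
  rw [← h0, ← h1]
  exact ofReal_log_le_hyperbolicLength hΩ hs hc hγ hm

/-- Each point of `E` is within `|z₁ - c| (exp (2 h) - 1)` of `z₁ ∈ E`, with `h = h_Ω(E)`. This bounds
`d(E) / d(E, ∂Ω)` by `2 (exp (2 h) - 1) ≤ exp (4 h) - 1`. -/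
theorem one_quarter_le_kappaQuotient {Ω : Set ℂ} (hΩ : IsOpen Ω) (hs : IsSimplyConnected Ω)
    (hne : Ω ≠ univ) {E : Set ℂ} (hE : IsCompact E) (hEΩ : E ⊆ Ω) (hnt : E.Nontrivial) :
    1 / 4 ≤ kappaQuotient Ω E := by
  rw [kappaQuotient]
  by_cases htop : hyperbolicDiam Ω E = ⊤
  · rw [htop, ENNReal.top_div_of_ne_top ENNReal.ofReal_ne_top]
    exact le_top
  have hfr : ∀ c ∈ frontier Ω, c ∉ Ω := fun c hc hcΩ =>
    Set.disjoint_left.1 (disjoint_frontier_iff_isOpen.2 hΩ) hc hcΩ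
  obtain ⟨c₀, hc₀⟩ : (frontier Ω).Nonempty := nonempty_frontier_iff.2 ⟨hs.nonempty, hne⟩
  set h := (hyperbolicDiam Ω E).toReal with hh
  set K := 2 * (Real.exp (2 * h) - 1) with hK
  have hdist : ∀ z₁ ∈ E, ∀ z₂ ∈ E, ∀ c ∈ frontier Ω, 2 * ‖z₂ - z₁‖ ≤ K * ‖z₁ - c‖ := by
    intro z₁ h1 z₂ h2 c hc
    have hpos : 0 < ‖z₁ - c‖ :=
      norm_pos_iff.2 (sub_ne_zero.2 (ne_of_mem_of_not_mem (hEΩ h1) (hfr c hc)))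
    have h3 : ENNReal.ofReal (1 / 2 * Real.log (1 + ‖z₂ - z₁‖ / ‖z₁ - c‖)) ≤ hyperbolicDiam Ω E :=
      (ofReal_log_le_hyperbolicDist hΩ hs (hfr c hc) z₁ z₂).trans
        (le_iSup₂_of_le z₁ h1 (le_iSup₂_of_le z₂ h2 le_rfl))
    rw [ENNReal.ofReal_le_iff_le_toReal htop] at h3
    have h4 : 1 + ‖z₂ - z₁‖ / ‖z₁ - c‖ ≤ Real.exp (2 * h) := by
      rw [← Real.log_le_iff_le_exp (by positivity)]
      linarith
    have h5 : ‖z₂ - z₁‖ / ‖z₁ - c‖ ≤ Real.exp (2 * h) - 1 := by linarith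
    rw [div_le_iff₀ hpos] at h5
    rw [hK]
    linarith
  have hdiam : ∀ z₁ ∈ E, ∀ c ∈ frontier Ω, diam E ≤ K * ‖z₁ - c‖ := by
    intro z₁ h1 c hc
    have hnn : 0 ≤ K * ‖z₁ - c‖ := by
      have := hdist z₁ h1 z₁ h1 c hc
      simpa using this
    refine diam_le_of_forall_dist_le hnn fun x hx y hy => ?_
    have h2 := hdist z₁ h1 x hx c hc
    have h3 := hdist z₁ h1 y hy c hc
    have h4 := dist_triangle_right x y z₁
    rw [dist_eq_norm x z₁, dist_eq_norm y z₁] at h4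
    linarith
  obtain ⟨x, hx, y, hy, hxy⟩ := hnt
  have hdpos : 0 < diam E :=
    (dist_pos.2 hxy).trans_le (dist_le_diam_of_mem hE.isBounded hx hy)
  have hKpos : 0 < K := by
    have := hdiam x hx c₀ hc₀
    by_contra! hle
    nlinarith [norm_nonneg (x - c₀)]
  have hsInf : diam E / K ≤ euclideanSetDist E (frontier Ω) := by
    refine le_csInf ⟨_, mem_image2_of_mem hx hc₀⟩ ?_
    rintro _ ⟨z, hz, c, hc, rfl⟩
    rw [div_le_iff₀ hKpos, dist_eq_norm, mul_comm]
    exact hdiam z hz c hc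
  have hδ : 0 < euclideanSetDist E (frontier Ω) := (div_pos hdpos hKpos).trans_le hsInf
  have hexp : 1 < Real.exp (2 * h) := by linarith
  have hhpos : 0 < h := by
    have := Real.one_lt_exp_iff.1 hexp
    linarith
  have hJ : distanceRatioFunctional Ω E ≤ 4 * h := by
    rw [distanceRatioFunctional, Real.log_le_iff_le_exp (by positivity)]
    rw [div_le_iff₀ hKpos] at hsInf
    have h1 : diam E / euclideanSetDist E (frontier Ω) ≤ K := by
      rw [div_le_iff₀ hδ]
      linarith
    have h2 : Real.exp (4 * h) = Real.exp (2 * h) ^ 2 := by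
      rw [← Real.exp_nat_mul]
      congr 1
      push_cast
      ring
    rw [h2]
    nlinarith [sq_nonneg (Real.exp (2 * h) - 1)]
  have hd0 : hyperbolicDiam Ω E ≠ 0 := fun h0 => by
    rw [hh, h0, ENNReal.toReal_zero] at hhpos
    exact lt_irrefl _ hhpos
  rw [ENNReal.le_div_iff_mul_le (Or.inr hd0) (Or.inr htop), ← ENNReal.ofReal_toReal htop, ← hh]
  have h4 : (1 / 4 : ℝ≥0∞) = ENNReal.ofReal (1 / 4) := by
    rw [ENNReal.ofReal_div_of_pos (by norm_num)]
    simp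
  rw [h4, ← ENNReal.ofReal_mul (by norm_num)]
  exact ENNReal.ofReal_le_ofReal (by linarith)

theorem one_quarter_le_kappaZero : 1 / 4 ≤ kappaZero :=
  le_iInf fun _ => le_iInf fun hΩ => le_iInf fun hs => le_iInf fun hne =>
    le_iInf fun _ => le_iInf fun hE => le_iInf fun hEΩ => le_iInf fun hnt =>
      one_quarter_le_kappaQuotient hΩ hs hne hE hEΩ hnt

/-! ### Upper bounds for the hyperbolic distance -/

/-- The image of the radius from `0` to `p` under a holomorphic covering has hyperbolic length at
most `∫₀¹ 2 |p| / (1 - t² |p|²) dt`. -/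
theorem IsHolomorphicDiskCovering.hyperbolicDist_le {f : ℂ → ℂ} {Ω : Set ℂ}
    (hf : IsHolomorphicDiskCovering f Ω) {p : ℂ} (hp : p ∈ ball (0 : ℂ) 1) :
    hyperbolicDist Ω (f 0) (f p) ≤ ENNReal.ofReal (Real.log ((1 + ‖p‖) / (1 - ‖p‖))) := by
  rw [mem_ball_zero_iff] at hp
  set r := ‖p‖ with hr
  have hr0 : 0 ≤ r := norm_nonneg p
  have hmem : ∀ t ∈ Icc (0 : ℝ) 1, (t : ℂ) * p ∈ ball (0 : ℂ) 1 := by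
    intro t ht
    rw [mem_ball_zero_iff, norm_mul, Complex.norm_real, Real.norm_of_nonneg ht.1]
    nlinarith [ht.2]
  have htr : ∀ t ∈ Icc (0 : ℝ) 1, 0 < 1 - t * r ∧ 0 < 1 + t * r := by
    intro t ht
    have h1 : t * r ≤ r := mul_le_of_le_one_left hr0 ht.2
    have h2 : 0 ≤ t * r := mul_nonneg ht.1 hr0
    exact ⟨by linarith, by linarith⟩
  have hγ : ContDiffOn ℝ 1 (fun t : ℝ => f (t * p)) (Icc 0 1) := by
    have h1 : ContDiffOn ℂ 1 f (ball 0 1) := hf.differentiableOn.contDiffOn isOpen_ball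
    refine (h1.restrict_scalars ℝ).comp ?_ hmem
    exact (Complex.ofRealCLM.contDiff.mul contDiff_const).contDiffOn
  have hm : MapsTo (fun t : ℝ => f (t * p)) (Icc 0 1) Ω := fun t ht =>
    hf.image_eq ▸ mem_image_of_mem f (hmem t ht)
  have hder : ∀ t ∈ Icc (0 : ℝ) 1,
      HasDerivAt (fun t : ℝ => f (t * p)) (deriv f (t * p) * p) t := by
    intro t ht
    have h1 : HasDerivAt f (deriv f (t * p)) ((t : ℂ) * p) :=
      (hf.differentiableOn.differentiableAt (isOpen_ball.mem_nhds (hmem t ht))).hasDerivAt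
    have h2 : HasDerivAt (fun z : ℂ => f (z * p)) (deriv f (t * p) * p) (t : ℂ) := by
      have h3 := HasDerivAt.comp (t : ℂ) (h₂ := f) (h := fun z => z * p) h1
        ((hasDerivAt_id (t : ℂ)).mul_const p)
      rwa [one_mul] at h3
    exact h2.comp_ofReal
  have hlen : hyperbolicDist Ω (f 0) (f p) ≤ hyperbolicLength Ω fun t : ℝ => f (t * p) :=
    iInf_le_of_le _ (iInf_le_of_le hγ (iInf_le_of_le hm
      (iInf_le_of_le (by simp) (iInf_le_of_le (by simp) le_rfl))))
  refine hlen.trans ?_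
  have hint : ∫ t in (0 : ℝ)..1, 2 * r / (1 - (t * r) ^ 2) = Real.log ((1 + r) / (1 - r)) := by
    have h1 := intervalIntegral.integral_eq_sub_of_hasDerivAt (a := 0) (b := 1)
      (f := fun t => Real.log (1 + t * r) - Real.log (1 - t * r))
      (f' := fun t => 2 * r / (1 - (t * r) ^ 2)) ?_ ?_
    · rw [h1, Real.log_div (by linarith) (by linarith)]
      simp
    · intro t ht
      rw [uIcc_of_le zero_le_one] at ht
      obtain ⟨h2, h3⟩ := htr t ht
      have hid : HasDerivAt (fun t : ℝ => t * r) r t := by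
        simpa using (hasDerivAt_id t).mul_const r
      refine (((hid.const_add 1).log h3.ne').sub ((hid.const_sub 1).log h2.ne')).congr_deriv ?_
      rw [show 1 - (t * r) ^ 2 = (1 + t * r) * (1 - t * r) by ring,
        div_sub_div _ _ h3.ne' h2.ne']
      congr 1
      ring
    · refine ContinuousOn.intervalIntegrable ?_
      rw [uIcc_of_le zero_le_one]
      refine continuousOn_const.div (by fun_prop) fun t ht => ?_
      rw [show 1 - (t * r) ^ 2 = (1 + t * r) * (1 - t * r) by ring]
      exact (mul_pos (htr t ht).2 (htr t ht).1).ne'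
  have hcont : ContinuousOn (fun t => 2 * r / (1 - (t * r) ^ 2)) (Icc 0 1) := by
    refine continuousOn_const.div (by fun_prop) fun t ht => ?_
    rw [show 1 - (t * r) ^ 2 = (1 + t * r) * (1 - t * r) by ring]
    exact (mul_pos (htr t ht).2 (htr t ht).1).ne'
  have hnn : ∀ t ∈ Icc (0 : ℝ) 1, 0 < 1 - (t * r) ^ 2 := by
    intro t ht
    rw [show 1 - (t * r) ^ 2 = (1 + t * r) * (1 - t * r) by ring]
    exact mul_pos (htr t ht).2 (htr t ht).1
  rw [← hint, intervalIntegral.integral_of_le zero_le_one, ← integral_Icc_eq_integral_Ioc,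
    ofReal_integral_eq_lintegral_ofReal hcont.integrableOn_Icc (by
      filter_upwards [ae_restrict_mem measurableSet_Icc] with t ht
      exact div_nonneg (by positivity) (hnn t ht).le)]
  refine setLIntegral_mono' measurableSet_Icc fun t ht => ?_
  have hρ : hyperbolicDensity Ω (f (t * p))
      ≤ ENNReal.ofReal (2 / (1 - ‖(t : ℂ) * p‖ ^ 2) / ‖deriv f (t * p)‖) :=
    iInf_le_of_le f (iInf_le_of_le hf (iInf_le_of_le _ (iInf_le_of_le (hmem t ht)
      (iInf_le_of_le rfl le_rfl))))
  have hnorm : ‖(t : ℂ) * p‖ = t * r := by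
    rw [norm_mul, Complex.norm_real, Real.norm_of_nonneg ht.1]
  rw [hnorm] at hρ
  rw [(hder t ht).deriv, ← ofReal_norm]
  refine (mul_le_mul_left hρ _).trans ?_
  have h1 := hnn t ht
  rw [← ENNReal.ofReal_mul (by positivity), norm_mul, ← hr]
  refine ENNReal.ofReal_le_ofReal ?_
  rw [← mul_assoc, mul_div_right_comm]
  refine mul_le_mul_of_nonneg_right ?_ hr0
  -- At a critical point the division by zero makes the left side `0`.
  rcases eq_or_ne ‖deriv f (t * p)‖ 0 with h0 | h0
  · rw [h0, mul_zero]
    positivity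
  · rw [div_mul_cancel₀ _ h0]

/-! ### Uniformization of the slit plane -/

theorem Homeomorph.isCoveringMap_coe {E X : Type*} [TopologicalSpace E] [TopologicalSpace X]
    (e : E ≃ₜ X) : IsCoveringMap e := by
  intro x
  have h : IsEvenlyCovered e x PUnit.{1} := ⟨inferInstance, univ, mem_univ x, isOpen_univ,
    isOpen_univ.preimage e.continuous,
    ((Homeomorph.setCongr preimage_univ).trans (Homeomorph.Set.univ E)).trans
      (e.trans ((Homeomorph.Set.univ X).symm.trans (Homeomorph.prodPUnit _).symm)), fun _ => rfl⟩
  exact h.to_isEvenlyCovered_preimage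

theorem re_sqrt_pos {z : ℂ} (hz : z ∈ slitPlane) : 0 < (Complex.sqrt z).re := by
  rw [Complex.sqrt, Complex.cpow_inv_two_re]
  refine Real.sqrt_pos.2 (half_pos ?_)
  rcases mem_slitPlane_iff.1 hz with h | h
  · linarith [norm_nonneg z]
  · have := (Complex.abs_re_lt_norm (z := z)).2 h
    linarith [neg_abs_le z.re]

theorem sqrt_sq_of_re_pos {u : ℂ} (hu : 0 < u.re) (hsl : u ^ 2 ∈ slitPlane) :
    Complex.sqrt (u ^ 2) = u := by
  have h1 : Complex.sqrt (u ^ 2) ^ 2 = u ^ 2 := by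
    rw [Complex.sqrt]
    exact Complex.cpow_nat_inv_pow _ two_ne_zero
  rcases sq_eq_sq_iff_eq_or_eq_neg.1 h1 with h | h
  · exact h
  · have h2 := re_sqrt_pos hsl
    rw [h, Complex.neg_re] at h2
    linarith

theorem sq_mem_slitPlane {u : ℂ} (hu : 0 < u.re) : u ^ 2 ∈ slitPlane := by
  rw [mem_slitPlane_iff, sq, Complex.mul_re, Complex.mul_im]
  by_cases h : u.im = 0
  · left
    rw [h]
    nlinarith
  · right
    intro h2
    have : u.re * u.im = 0 := by linarith
    exact (mul_ne_zero hu.ne' h) this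

/-- The conformal map of the disk onto the slit plane that sends `0` to `ζ²`: a Möbius map onto the
right half-plane followed by squaring. -/
noncomputable def slitPlaneMap (ζ w : ℂ) : ℂ := ((ζ + (starRingEnd ℂ) ζ * w) / (1 - w)) ^ 2

/-- The inverse of the Möbius factor of `slitPlaneMap ζ`. -/
noncomputable def halfPlaneToDisk (ζ u : ℂ) : ℂ := (u - ζ) / (u + (starRingEnd ℂ) ζ)

theorem add_conj_ne_zero {ζ u : ℂ} (hζ : 0 < ζ.re) (hu : 0 < u.re) :
    u + (starRingEnd ℂ) ζ ≠ 0 := by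
  intro h
  have := congrArg Complex.re h
  simp only [Complex.add_re, Complex.conj_re, Complex.zero_re] at this
  linarith

theorem halfPlaneToDisk_mem_ball {ζ u : ℂ} (hζ : 0 < ζ.re) (hu : 0 < u.re) :
    halfPlaneToDisk ζ u ∈ ball (0 : ℂ) 1 := by
  rw [mem_ball_zero_iff, halfPlaneToDisk, norm_div,
    div_lt_one (norm_pos_iff.2 (add_conj_ne_zero hζ hu)),
    ← sq_lt_sq₀ (norm_nonneg _) (norm_nonneg _), ← Complex.normSq_eq_norm_sq,
    ← Complex.normSq_eq_norm_sq, Complex.normSq_apply, Complex.normSq_apply]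
  simp only [Complex.sub_re, Complex.sub_im, Complex.add_re, Complex.add_im, Complex.conj_re,
    Complex.conj_im]
  nlinarith [mul_pos hζ hu]

theorem one_sub_ne_zero_of_mem_ball {w : ℂ} (hw : w ∈ ball (0 : ℂ) 1) : 1 - w ≠ 0 := by
  intro h
  rw [mem_ball_zero_iff, ← sub_eq_zero.1 h, norm_one] at hw
  exact lt_irrefl _ hw

theorem re_mobius_pos {ζ w : ℂ} (hζ : 0 < ζ.re) (hw : w ∈ ball (0 : ℂ) 1) :
    0 < ((ζ + (starRingEnd ℂ) ζ * w) / (1 - w)).re := by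
  have hne := one_sub_ne_zero_of_mem_ball hw
  rw [mem_ball_zero_iff] at hw
  have hw2 : normSq w < 1 := by
    rw [Complex.normSq_eq_norm_sq]
    nlinarith [norm_nonneg w]
  rw [Complex.normSq_apply] at hw2
  rw [Complex.div_re, ← add_div]
  refine div_pos ?_ (normSq_pos.2 hne)
  simp only [Complex.add_re, Complex.add_im, Complex.mul_re, Complex.mul_im, Complex.conj_re,
    Complex.conj_im, Complex.sub_re, Complex.sub_im, Complex.one_re, Complex.one_im]
  nlinarith [mul_pos hζ (sub_pos.2 hw2)]

theorem mobius_halfPlaneToDisk {ζ u : ℂ} (hζ : 0 < ζ.re) (hu : 0 < u.re) :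
    (ζ + (starRingEnd ℂ) ζ * halfPlaneToDisk ζ u) / (1 - halfPlaneToDisk ζ u) = u := by
  have h1 := one_sub_ne_zero_of_mem_ball (halfPlaneToDisk_mem_ball hζ hu)
  have h2 := add_conj_ne_zero hζ hu
  rw [div_eq_iff h1, halfPlaneToDisk]
  field_simp
  ring

theorem halfPlaneToDisk_mobius {ζ w : ℂ} (hζ : 0 < ζ.re) (hw : w ∈ ball (0 : ℂ) 1) :
    halfPlaneToDisk ζ ((ζ + (starRingEnd ℂ) ζ * w) / (1 - w)) = w := by
  have h1 := one_sub_ne_zero_of_mem_ball hw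
  have h2 := add_conj_ne_zero hζ (re_mobius_pos hζ hw)
  rw [halfPlaneToDisk, div_eq_iff h2]
  field_simp
  ring

theorem isHolomorphicDiskCovering_slitPlaneMap {ζ : ℂ} (hζ : 0 < ζ.re) :
    IsHolomorphicDiskCovering (slitPlaneMap ζ) slitPlane := by
  have hmaps : MapsTo (slitPlaneMap ζ) (ball 0 1) slitPlane := fun w hw =>
    sq_mem_slitPlane (re_mobius_pos hζ hw)
  have hinv : MapsTo (fun z => halfPlaneToDisk ζ (Complex.sqrt z)) slitPlane (ball 0 1) :=
    fun z hz => halfPlaneToDisk_mem_ball hζ (re_sqrt_pos hz)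
  have hleft : ∀ w ∈ ball (0 : ℂ) 1, halfPlaneToDisk ζ (Complex.sqrt (slitPlaneMap ζ w)) = w := by
    intro w hw
    rw [slitPlaneMap, sqrt_sq_of_re_pos (re_mobius_pos hζ hw)
      (sq_mem_slitPlane (re_mobius_pos hζ hw)), halfPlaneToDisk_mobius hζ hw]
  have hright : ∀ z ∈ slitPlane, slitPlaneMap ζ (halfPlaneToDisk ζ (Complex.sqrt z)) = z := by
    intro z hz
    rw [slitPlaneMap, mobius_halfPlaneToDisk hζ (re_sqrt_pos hz), Complex.sqrt]
    exact Complex.cpow_nat_inv_pow _ two_ne_zero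
  have hdiff : DifferentiableOn ℂ (slitPlaneMap ζ) (ball 0 1) := by
    refine DifferentiableOn.pow (DifferentiableOn.div (by fun_prop) (by fun_prop) ?_) 2
    exact fun w hw => one_sub_ne_zero_of_mem_ball hw
  have hcinv : ContinuousOn (fun z => halfPlaneToDisk ζ (Complex.sqrt z)) slitPlane :=
    (continuousOn_sqrt.sub continuousOn_const).div (continuousOn_sqrt.add continuousOn_const)
      fun z hz => add_conj_ne_zero hζ (re_sqrt_pos hz)
  refine ⟨hdiff, Subset.antisymm hmaps.image_subset fun z hz => ⟨_, hinv hz, hright z hz⟩,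
    fun h => ?_⟩
  let e : ball (0 : ℂ) 1 ≃ₜ slitPlane :=
    { toFun := h.restrict
      invFun := hinv.restrict
      left_inv := fun w => Subtype.ext (hleft w w.2)
      right_inv := fun z => Subtype.ext (hright z z.2)
      continuous_toFun := hdiff.continuousOn.mapsToRestrict h
      continuous_invFun := hcinv.mapsToRestrict hinv }
  exact e.isCoveringMap_coe

/-- Upper bound for the hyperbolic distance in the slit plane in terms of the pseudohyperbolic
distance of the square roots in the right half-plane. -/
theorem hyperbolicDist_slitPlane_le {ζ u : ℂ} (hζ : 0 < ζ.re) (hu : 0 < u.re) {P : ℝ} (hP : P < 1)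
    (h : ‖u - ζ‖ ≤ P * ‖u + (starRingEnd ℂ) ζ‖) :
    hyperbolicDist slitPlane (ζ ^ 2) (u ^ 2) ≤ ENNReal.ofReal (Real.log ((1 + P) / (1 - P))) := by
  have hball := halfPlaneToDisk_mem_ball hζ hu
  have hd := (isHolomorphicDiskCovering_slitPlaneMap hζ).hyperbolicDist_le hball
  rw [slitPlaneMap, slitPlaneMap, mobius_halfPlaneToDisk hζ hu] at hd
  simp only [mul_zero, add_zero, sub_zero, div_one] at hd
  refine hd.trans (ENNReal.ofReal_le_ofReal ?_)
  have hle : ‖halfPlaneToDisk ζ u‖ ≤ P := by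
    rw [halfPlaneToDisk, norm_div, div_le_iff₀ (norm_pos_iff.2 (add_conj_ne_zero hζ hu))]
    exact h
  have hnn := norm_nonneg (halfPlaneToDisk ζ u)
  have h1 : 0 < 1 - P := by linarith
  have h2 : 0 < 1 - ‖halfPlaneToDisk ζ u‖ := by linarith
  have h3 : 0 ≤ P := hnn.trans hle
  refine Real.log_le_log (by positivity) ?_
  gcongr

/-! ### The three-point set in the slit plane -/

theorem isSimplyConnected_slitPlane : IsSimplyConnected slitPlane := by
  have h := starConvex_one_slitPlane.contractibleSpace ⟨1, one_mem_slitPlane⟩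
  exact SimplyConnectedSpace.ofContractible slitPlane

theorem slitPlane_ne_univ : slitPlane ≠ univ :=
  (ne_univ_iff_exists_notMem _).2 ⟨0, zero_notMem_slitPlane⟩

theorem threePointSet_subset_slitPlane : threePointSet ⊆ slitPlane := by
  rintro z (rfl | rfl | rfl) <;> rw [mem_slitPlane_iff] <;> left <;> norm_num

theorem isCompact_threePointSet : IsCompact threePointSet :=
  Set.Finite.isCompact (by rw [threePointSet]; exact toFinite _)

theorem threePointSet_nontrivial : threePointSet.Nontrivial := by
  refine ⟨_, Or.inr (Or.inl rfl), _, Or.inr (Or.inr rfl), fun h => ?_⟩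
  have := congrArg Complex.im h
  norm_num at this

theorem zero_mem_frontier_slitPlane : (0 : ℂ) ∈ frontier slitPlane := by
  rw [isOpen_slitPlane.frontier_eq]
  refine ⟨Metric.mem_closure_iff.2 fun ε hε => ⟨((ε / 2 : ℝ) : ℂ), ?_, ?_⟩, zero_notMem_slitPlane⟩
  · rw [ofReal_mem_slitPlane]
    positivity
  · rw [dist_zero_left, Complex.norm_real, Real.norm_of_nonneg (by positivity)]
    linarith

theorem euclideanSetDist_threePointSet :
    euclideanSetDist threePointSet (frontier slitPlane) = 1 := by
  have hlow : ∀ x ∈ image2 dist threePointSet (frontier slitPlane), 1 ≤ x := by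
    rintro _ ⟨z, hz, c, hc, rfl⟩
    have hcn : c ∉ slitPlane := fun h =>
      Set.disjoint_left.1 (disjoint_frontier_iff_isOpen.2 isOpen_slitPlane) hc h
    rw [mem_slitPlane_iff, not_or, not_lt] at hcn
    have hz1 : 1 ≤ z.re := by
      rcases hz with rfl | rfl | rfl <;> norm_num
    rw [dist_eq_norm]
    refine le_trans ?_ (Complex.re_le_norm _)
    rw [Complex.sub_re]
    linarith [hcn.1]
  have hmem : (1 : ℝ) ∈ image2 dist threePointSet (frontier slitPlane) :=
    ⟨1, Or.inl rfl, 0, zero_mem_frontier_slitPlane, by simp⟩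
  exact le_antisymm (csInf_le ⟨1, hlow⟩ hmem) (le_csInf ⟨1, hmem⟩ hlow)

theorem log_le_distanceRatioFunctional_threePointSet :
    Real.log 3.396953362 ≤ distanceRatioFunctional slitPlane threePointSet := by
  rw [distanceRatioFunctional, euclideanSetDist_threePointSet, div_one]
  refine Real.log_le_log (by norm_num) ?_
  have h1 := dist_le_diam_of_mem isCompact_threePointSet.isBounded
    (x := (⟨2.121820474, 1.198476681⟩ : ℂ)) (y := (⟨2.121820474, -1.198476681⟩ : ℂ))
    (Or.inr (Or.inl rfl)) (Or.inr (Or.inr rfl))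
  have h2 := (Complex.abs_im_le_norm
    ((⟨2.121820474, 1.198476681⟩ : ℂ) - ⟨2.121820474, -1.198476681⟩))
  rw [← dist_eq_norm, Complex.sub_im] at h2
  norm_num at h1 h2 ⊢
  linarith

/-- All pairs among `1`, `ζ`, `conj ζ`, the square roots of the three points, have pseudohyperbolic
distance less than `0.254258` in the right half-plane; the three distances agree to nine digits. -/
theorem hyperbolicDiam_threePointSet_le :
    hyperbolicDiam slitPlane threePointSet
      ≤ ENNReal.ofReal (Real.log ((1 + 0.254258) / (1 - 0.254258))) := by
  set w : ℂ := ⟨2.121820474, 1.198476681⟩ with hw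
  obtain ⟨ζ, hζw, hζ⟩ : ∃ ζ : ℂ, ζ ^ 2 = w ∧ 0 < ζ.re :=
    ⟨Complex.sqrt w, Complex.cpow_nat_inv_pow _ two_ne_zero,
      re_sqrt_pos (threePointSet_subset_slitPlane (Or.inr (Or.inl rfl)))⟩
  have hζw' : ((starRingEnd ℂ) ζ) ^ 2 = ⟨2.121820474, -1.198476681⟩ := by
    rw [← map_pow, hζw]
    rfl
  have hre : ζ.re ^ 2 - ζ.im ^ 2 = 2.121820474 := by
    have := congrArg Complex.re hζw
    rw [sq, Complex.mul_re] at this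
    rw [hw] at this
    linarith
  have him : 2 * (ζ.re * ζ.im) = 1.198476681 := by
    have := congrArg Complex.im hζw
    rw [sq, Complex.mul_im] at this
    rw [hw] at this
    linarith
  have hb0 : 0 < ζ.im := by
    by_contra! hle
    nlinarith
  -- Numerical enclosures of the real and imaginary parts of `ζ`.
  have ha1 : 1.5097545793 < ζ.re := by
    by_contra! hle
    have h1 : 0.396911 < ζ.im := by by_contra! h2; nlinarith
    nlinarith
  have ha2 : ζ.re < 1.5097545794 := by
    by_contra! hle
    have h1 : ζ.im < 0.396912 := by by_contra! h2; nlinarith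
    nlinarith
  have hb2 : ζ.im < 0.3969110932 := by by_contra! h; nlinarith
  have h1ζ : (ζ.re - 1) ^ 2 + ζ.im ^ 2 ≤ 0.254258 ^ 2 * ((ζ.re + 1) ^ 2 + ζ.im ^ 2) := by
    nlinarith
  have hζζ : (2 * ζ.im) ^ 2 ≤ 0.254258 ^ 2 * ((2 * ζ.re) ^ 2 + (2 * ζ.im) ^ 2) := by
    nlinarith
  have hpair : ∀ u v : ℂ, 0 < u.re → 0 < v.re → (v.re - u.re) ^ 2 + (v.im - u.im) ^ 2
      ≤ 0.254258 ^ 2 * ((v.re + u.re) ^ 2 + (v.im - u.im) ^ 2) →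
      hyperbolicDist slitPlane (u ^ 2) (v ^ 2)
        ≤ ENNReal.ofReal (Real.log ((1 + 0.254258) / (1 - 0.254258))) := by
    intro u v hu hv h
    refine hyperbolicDist_slitPlane_le hu hv (by norm_num) ?_
    rw [← sq_le_sq₀ (norm_nonneg _) (by positivity), mul_pow, ← Complex.normSq_eq_norm_sq,
      ← Complex.normSq_eq_norm_sq, Complex.normSq_apply, Complex.normSq_apply]
    simp only [Complex.sub_re, Complex.sub_im, Complex.add_re, Complex.add_im, Complex.conj_re,
      Complex.conj_im]
    linarith
  have hroot : ∀ z ∈ threePointSet,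
      ∃ u : ℂ, (u = 1 ∨ u = ζ ∨ u = (starRingEnd ℂ) ζ) ∧ u ^ 2 = z := by
    rintro z (rfl | rfl | rfl)
    · exact ⟨1, Or.inl rfl, one_pow 2⟩
    · exact ⟨ζ, Or.inr (Or.inl rfl), hζw⟩
    · exact ⟨_, Or.inr (Or.inr rfl), hζw'⟩
  refine iSup₂_le fun z₁ hz₁ => iSup₂_le fun z₂ hz₂ => ?_
  obtain ⟨u, hu, rfl⟩ := hroot z₁ hz₁
  obtain ⟨v, hv, rfl⟩ := hroot z₂ hz₂
  rcases hu with rfl | rfl | rfl <;> rcases hv with rfl | rfl | rfl <;> apply hpair <;>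
    (try simp only [Complex.one_re, Complex.one_im, Complex.conj_re, Complex.conj_im]) <;>
    nlinarith

/-- The numerical comparison, from partial sums of the series of `log ((1 + x) / (1 - x))`: the
logarithm of `3.396953362` is computed as that of `4 (1 - x) / (1 + x)`, `x = 301523319/3698476681`.
The two sides differ by less than `10⁻⁷`. -/
theorem log_lt_mul_log : Real.log ((1 + 0.254258) / (1 - 0.254258))
    < 0.4251605 * Real.log 3.396953362 := by
  have h1 := Real.log_div_le_sum_range_add (x := 0.254258) (by norm_num) (by norm_num) 9
  have h2 := Real.log_div_le_sum_range_add (x := 301523319 / 3698476681) (by norm_num)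
    (by norm_num) 4
  have h3 : Real.log 3.396953362 = 2 * Real.log 2 - Real.log ((1 + 301523319 / 3698476681)
      / (1 - 301523319 / 3698476681)) := by
    rw [show (2 : ℝ) * Real.log 2 = Real.log (2 ^ 2) by rw [Real.log_pow]; norm_num,
      ← Real.log_div (by norm_num) (by norm_num)]
    norm_num
  have h4 := Real.log_two_gt_d9
  rw [h3]
  simp only [Finset.sum_range_succ, Finset.sum_range_zero] at h1 h2
  norm_num at h1 h2 h4 ⊢
  linarith

theorem kappaQuotient_threePointSet_lt :
    kappaQuotient slitPlane threePointSet < ENNReal.ofReal 0.4251605 := by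
  refine ENNReal.div_lt_of_lt_mul (hyperbolicDiam_threePointSet_le.trans_lt ?_)
  rw [← ENNReal.ofReal_mul (by norm_num)]
  have h1 := log_le_distanceRatioFunctional_threePointSet
  have h2 : 0 < Real.log 3.396953362 := Real.log_pos (by norm_num)
  have h3 := log_lt_mul_log
  have h4 : Real.log ((1 + 0.254258) / (1 - 0.254258))
      < 0.4251605 * distanceRatioFunctional slitPlane threePointSet := by
    linarith
  exact (ENNReal.ofReal_lt_ofReal_iff (by linarith)).2 h4

theorem corollary1p5 :
    1 / 4 ≤ kappaZero ∧
    kappaZero < ENNReal.ofReal 0.4251605 ∧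
    kappaZero ≤ kappa Complex.slitPlane ∧
    kappa Complex.slitPlane ≤ kappaQuotient Complex.slitPlane threePointSet ∧
    kappaQuotient Complex.slitPlane threePointSet < ENNReal.ofReal 0.4251605 := by
  have h1 : kappaZero ≤ kappa slitPlane :=
    iInf_le_of_le _ (iInf_le_of_le isOpen_slitPlane (iInf_le_of_le isSimplyConnected_slitPlane
      (iInf_le_of_le slitPlane_ne_univ le_rfl)))
  have h2 : kappa slitPlane ≤ kappaQuotient slitPlane threePointSet :=
    iInf_le_of_le _ (iInf_le_of_le isCompact_threePointSet
      (iInf_le_of_le threePointSet_subset_slitPlane (iInf_le_of_le threePointSet_nontrivial le_rfl)))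
  exact ⟨one_quarter_le_kappaZero, (h1.trans h2).trans_lt kappaQuotient_threePointSet_lt, h1, h2,
    kappaQuotient_threePointSet_lt⟩
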